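/- **Setting.** Let $n\ge 0$, $N\ge 1$ and $[N]=\{1,\dots,N\}$; $\mathbb R^n$ carries the Euclidean inner product and norm. Consider minimizing $\varphi(z)=\frac1N\sum_{i=1}^N f_i(z)+g(z)$ over $z\in\mathbb R^n$, where, for each $i\in[N]$, $h_i:\mathbb R^n\to\mathbb R$ is strictly convex and continuously differentiable, $f_i:\mathbb R^n\to\mathbb R$ is $L_i$-smooth relative to $h_i$ (that is, $L_i\ge0$ and $L_ih_i\pm f_i$ are convex), $g:\mathbb R^n\to\mathbb R\cup\{+\infty\}$ is proper and lower semicontinuous, and $\operatorname{argmin}\varphi\neq\emptyset$. Let $\beta\in(0,1)$ and $\gamma_i>0$ with $\gamma_iL_i<N$ for $i\in[N]$. Put $\hat h_i=\frac1{\gamma_i}h_i-\frac1Nf_i$, $\hat h=\sum_{i=1}^N\hat h_i$, $D_{\hat h}(y,x)=\hat h(y)-\hat h(x)-\langle\nabla\hat h(x),y-x\rangle$, and $$T(s)=\operatorname*{argmin}_{w\in\mathbb R^n}\Big\{g(w)+\sum_{i=1}^N\tfrac1{\gamma_i}h_i(w)-\langle s,w\rangle\Big\},\qquad R(x)=\{x-w: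 w\in T(\nabla\hat h(x))\},\qquad \mathcal L(y,x)=\varphi(y)+D_{\hat h}(y,x).$$ **Algorithm (SPIRAL).** Given $z^{\rm init}\in\mathbb R^n$, set $s^0=\nabla\hat h(z^{\rm init})$. For $k=0,1,2,\dots$: 1. Take $z^k\in T(s^k)$ and $v^k\in T(\nabla\hat h(z^k))$, and choose a direction $d^k\in\mathbb R^n$. 2. (Linesearch.) For $\tau=1,\beta,\beta^2,\dots$ in turn, let $u=z^k+(1-\tau)(v^k-z^k)+\tau d^k$ and take $y\in T(\nabla\hat h(u))$; stop at the first $\tau$ for which $\mathcal L(y,u)\le\mathcal L(v^k,z^k)$, and let $\tau^k$ and $u^k$ be that $\tau$ and the corresponding $u$. 3. (Incremental loop.) Start with $s=\nabla\hat h(u^k)$. For $i$ running once through $[N]$, in an order that may be chosen anew for each $k$, take $\tilde z_i^k\in T(s)$ and replace $s$ by $s+\nabla\hat h_i(\tilde z_i^k)-\nabla\hat h_i(u^k)$. Let $s^{k+1}$ be the final $s$. **Theorem (superlinear convergence).** In this setting let $(z^k)_{k\in\mathbb N}$ be generated by the algorithm (in particular every linesearch terminates). Suppose moreover that $g$ is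 convex, that $f_i,h_i\in C^2(\mathbb R^n)$ with $\nabla^2h_i(x)\succ0$ for all $x\in\mathbb R^n$ and $i\in[N]$, and that: - $z^k\to z^\star$, where $z^\star$ is a strong local minimum of $\varphi$: there are $c>0$ and a neighborhood of $z^\star$ on which $\varphi(z)\ge\varphi(z^\star)+\frac c2\|z-z^\star\|^2$; - $T$ is strictly differentiable at $\nabla\hat h(z^\star)$: it is single-valued near that point and, as a function there, strictly differentiable at that point (consequently $R$ is single-valued near $z^\star$ and differentiable at $z^\star$, with Jacobian $JR(z^\star)$); - the directions satisfy the Dennis–Moré condition: for some $r^k\in R(z^k)$, $$\|r^k+JR(z^\star)d^k\|=o(\|d^k\|)\quad\text{as }k\to\infty,$$ that is, for every $\varepsilon>0$, $\|r^k+JR(z^\star)d^k\|\le\varepsilon\|d^k\|$ for all large $k$; when $d^k\ne0$ for all $k$ this says that $\big(r^k+JR(z^\star)d^k\big)/\|d^k\|\to0$. Then the unit stepsize is eventually always accepted, i.e. $\tau^k=1$ for all sufficiently large $k$, and $(z^k)$ converges to $z^\star$ superlinearly: $z^k\to z^\star$ and either $z^k=z^\star$ for some $k$, or $\lim_{k\to\infty}\|z^{k+1}-z^\star\|/\|z^k-z^\star\|=0$.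 -/

import Mathlib

open Filter Topology Asymptotics

namespace SPIRAL

noncomputable section

/-- The space `ℝⁿ` with its Euclidean norm and inner product. -/
abbrev E (n : ℕ) : Type := EuclideanSpace ℝ (Fin n)

/-! ### Functions, Bregman distances, relative smoothness -/

/-- Minimizers of an extended-real-valued function. -/
def argminSet {X : Type*} (ψ : X → EReal) : Set X := {w | ∀ x, ψ w ≤ ψ x}

/-- A proper function: it never takes the value `-∞` and it is finite somewhere. -/
def IsProper {X : Type*} (ψ : X → EReal) : Prop := (∀ x, ψ x ≠ ⊥) ∧ ∃ x, ψ x ≠ ⊤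

/-- Convexity of an extended-real-valued function: its epigraph is convex. -/
def IsConvexFun {n : ℕ} (ψ : E n → EReal) : Prop :=
  Convex ℝ {p : E n × ℝ | ψ p.1 ≤ (p.2 : EReal)}

/-- Distance-generating function: strictly convex and continuously differentiable. -/
def IsDGF {n : ℕ} (h : E n → ℝ) : Prop :=
  StrictConvexOn ℝ Set.univ h ∧ ContDiff ℝ 1 h

/-- Bregman distance `D_h(y, x) = h(y) - h(x) - ⟨∇h(x), y - x⟩`. -/
def bregman {n : ℕ} (h : E n → ℝ) (y x : E n) : ℝ :=
  h y - h x - inner ℝ (gradient h x) (y - x)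

/-- `f` is `L`-smooth relative to `h`: `L ≥ 0` and both `L h + f` and `L h - f` are convex. -/
def IsRelSmooth {n : ℕ} (L : ℝ) (h f : E n → ℝ) : Prop :=
  0 ≤ L ∧ ConvexOn ℝ Set.univ (fun x => L * h x + f x) ∧
    ConvexOn ℝ Set.univ (fun x => L * h x - f x)

/-- The Hessian of `h`, as the derivative of its gradient, is positive definite everywhere. -/
def HessianPosDef {n : ℕ} (h : E n → ℝ) : Prop :=
  ∀ x v : E n, v ≠ 0 → 0 < inner ℝ (fderiv ℝ (gradient h) x v) v

/-- `xs` is a strong local minimum of `ψ`: for some `c > 0`,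
`ψ x ≥ ψ xs + (c / 2) ‖x - xs‖²` for all `x` near `xs`. -/
def IsStrongLocalMin {n : ℕ} (ψ : E n → EReal) (xs : E n) : Prop :=
  ∃ c : ℝ, 0 < c ∧ ∀ᶠ x in 𝓝 xs, ψ xs + ((c / 2 * ‖x - xs‖ ^ 2 : ℝ) : EReal) ≤ ψ x

/-- Superlinear convergence: the sequence converges to `xs`, and either it hits `xs` or the
quotients of successive distances tend to zero. -/
def ConvergesSuperlinearly {n : ℕ} (x : ℕ → E n) (xs : E n) : Prop :=
  Tendsto x atTop (𝓝 xs) ∧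
    ((∃ k, x k = xs) ∨
      Tendsto (fun k => ‖x (k + 1) - xs‖ / ‖x k - xs‖) atTop (𝓝 0))

/-! ### Jacobians of set-valued maps -/

/-- The set-valued map `F` is single-valued near `x`, and there it is differentiable at `x` with
Jacobian `A`. -/
def HasJacobianAt {n : ℕ} (F : E n → Set (E n)) (A : E n →L[ℝ] E n) (x : E n) : Prop :=
  ∃ t : E n → E n, (∀ᶠ y in 𝓝 x, F y = {t y}) ∧ HasFDerivAt t A x

/-- The set-valued map `F` is single-valued near `x`, and there it is strictly differentiable
at `x`. -/
def IsStrictlyDifferentiableAt {n : ℕ} (F : E n → Set (E n)) (x : E n) : Prop :=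
  ∃ (t : E n → E n) (A : E n →L[ℝ] E n),
    (∀ᶠ y in 𝓝 x, F y = {t y}) ∧ HasStrictFDerivAt t A x

open Classical in
/-- The Jacobian of the set-valued map `F` at `x` (zero if there is none). -/
def jacobian {n : ℕ} (F : E n → Set (E n)) (x : E n) : E n →L[ℝ] E n :=
  if H : ∃ A, HasJacobianAt F A x then H.choose else 0

theorem HasJacobianAt.unique {n : ℕ} {F : E n → Set (E n)} {A B : E n →L[ℝ] E n} {x : E n}
    (hA : HasJacobianAt F A x) (hB : HasJacobianAt F B x) : A = B := by
  obtain ⟨t, ht, hA⟩ := hA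
  obtain ⟨r, hr, hB⟩ := hB
  have htr : t =ᶠ[𝓝 x] r := by
    filter_upwards [ht, hr] with y h1 h2
    exact Set.singleton_injective (h1.symm.trans h2)
  exact hA.unique (hB.congr_of_eventuallyEq htr)

theorem HasJacobianAt.jacobian_eq {n : ℕ} {F : E n → Set (E n)} {A : E n →L[ℝ] E n} {x : E n}
    (hA : HasJacobianAt F A x) : jacobian F x = A := by
  have H : ∃ B, HasJacobianAt F B x := ⟨A, hA⟩
  unfold jacobian
  rw [dif_pos H]
  exact H.choose_spec.unique hA

/-! ### The problem and the operators of the method -/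

section Operators

variable {n N : ℕ} (f h : Fin N → E n → ℝ) (g : E n → EReal) (γ : Fin N → ℝ)

/-- The cost `φ = (1/N) ∑ f_i + g`. -/
def cost (z : E n) : EReal := (((1 / (N : ℝ)) * ∑ i, f i z : ℝ) : EReal) + g z

/-- `ĥ_i = h_i / γ_i - f_i / N`. -/
def hhatI (i : Fin N) (x : E n) : ℝ := (1 / γ i) * h i x - (1 / (N : ℝ)) * f i x

/-- `ĥ = ∑ ĥ_i`. -/
def hhat (x : E n) : ℝ := ∑ i, hhatI f h γ i x

/-- The oracle `T(s) = argmin_w { g(w) + ∑ h_i(w) / γ_i - ⟨s, w⟩ }`. -/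
def oracle (s : E n) : Set (E n) :=
  argminSet fun w => g w + (((∑ i, (1 / γ i) * h i w) - inner ℝ s w : ℝ) : EReal)

/-- The residual mapping `R = id - T ∘ ∇ĥ`. -/
def residual (x : E n) : Set (E n) :=
  {r | ∃ w ∈ oracle h g γ (gradient (hhat f h γ) x), r = x - w}

/-- The Lyapunov function `ℒ(y, x) = φ(y) + D_ĥ(y, x)`. -/
def lyapunov (y x : E n) : EReal := cost f g y + (bregman (hhat f h γ) y x : EReal)

end Operators

/-- The trial point `z + (1 - τ)(v - z) + τ d` of the linesearch. -/
def trialPoint {n : ℕ} (z v d : E n) (τ : ℝ) : E n := z + (1 - τ) • (v - z) + τ • d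

/-- An infinite run of the algorithm SPIRAL: its iterates (with arbitrary directions `d k`,
arbitrary selections from the oracle, and a sweeping order chosen freely at every outer
iteration) and the rules by which they are generated. -/
structure SpiralRun {n N : ℕ} (f h : Fin N → E n → ℝ) (g : E n → EReal) (γ : Fin N → ℝ)
    (β : ℝ) where
  zinit : E n
  /-- `s k` is the vector at the start of outer iteration `k`. -/
  s : ℕ → E n
  z : ℕ → E n
  v : ℕ → E n
  d : ℕ → E n
  /-- Number of backtracks of the linesearch in iteration `k`. -/
  backtracks : ℕ → ℕ
  /-- `y k m` is the point drawn from the oracle in trial `m` of iteration `k`. -/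
  y : ℕ → ℕ → E n
  /-- Sweeping order of the incremental loop (the identity for the cyclic rule). -/
  sweep : ℕ → Equiv.Perm (Fin N)
  /-- `sIn k j` is the vector after `j` steps of the incremental loop. -/
  sIn : ℕ → ℕ → E n
  /-- `ztilde k j` is the point drawn from the oracle in step `j` of the incremental loop. -/
  ztilde : ℕ → Fin N → E n
  s_zero : s 0 = gradient (hhat f h γ) zinit
  z_mem : ∀ k, z k ∈ oracle h g γ (s k)
  v_mem : ∀ k, v k ∈ oracle h g γ (gradient (hhat f h γ) (z k))
  /-- Trials `0, …, backtracks k` are carried out, with stepsizes `β ^ m`. -/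
  y_mem : ∀ k m, m ≤ backtracks k →
    y k m ∈ oracle h g γ (gradient (hhat f h γ) (trialPoint (z k) (v k) (d k) (β ^ m)))
  /-- All trials before the last one are rejected. -/
  rejected : ∀ k m, m < backtracks k →
    lyapunov f h g γ (v k) (z k) <
      lyapunov f h g γ (y k m) (trialPoint (z k) (v k) (d k) (β ^ m))
  /-- The last trial is accepted. -/
  accepted : ∀ k,
    lyapunov f h g γ (y k (backtracks k))
        (trialPoint (z k) (v k) (d k) (β ^ backtracks k)) ≤
      lyapunov f h g γ (v k) (z k)
  sIn_zero : ∀ k, sIn k 0 =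
    gradient (hhat f h γ) (trialPoint (z k) (v k) (d k) (β ^ backtracks k))
  ztilde_mem : ∀ k (j : Fin N), ztilde k j ∈ oracle h g γ (sIn k (j : ℕ))
  sIn_succ : ∀ k (j : Fin N), sIn k ((j : ℕ) + 1) = sIn k (j : ℕ) +
    (gradient (hhatI f h γ (sweep k j)) (ztilde k j) -
      gradient (hhatI f h γ (sweep k j))
        (trialPoint (z k) (v k) (d k) (β ^ backtracks k)))
  s_succ : ∀ k, s (k + 1) = sIn k N

/-- The stepsize `τ^k` with which the linesearch of iteration `k` terminates. -/
def SpiralRun.τ {n N : ℕ} {f h : Fin N → E n → ℝ} {g : E n → EReal} {γ : Fin N → ℝ} {β : ℝ}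
    (run : SpiralRun f h g γ β) (k : ℕ) : ℝ := β ^ run.backtracks k

/-- The Dennis–Moré condition at `zs`: for some `r^k ∈ R(z^k)`,
`r^k + JR(zs) d^k = o(‖d^k‖)`. -/
def DennisMore {n N : ℕ} (f h : Fin N → E n → ℝ) (g : E n → EReal) (γ : Fin N → ℝ)
    (z d : ℕ → E n) (zs : E n) : Prop :=
  ∃ r : ℕ → E n, (∀ k, r k ∈ residual f h g γ (z k)) ∧
    (fun k => r k + jacobian (residual f h g γ) zs (d k)) =o[atTop] d

end

end SPIRAL

/-!
# Superlinear convergence of SPIRAL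

Up to a constant, the objective of the oracle at `∇ĥ(x)` is `ℒ(·, x) = φ + D_ĥ(·, x)`
(`mem_oracle_iff`). So near `zs` the map `p x = T(∇ĥ(x))` is the Bregman proximal mapping of `φ`, the
linesearch compares values of the Bregman envelope `min ℒ(·, x)`, and `R(x) = x - p x`.

* `zs` is a fixed point of `p`: a local minimizer of `φ` is a local, hence by convexity of `g` and of
  the `h_i` a global, minimizer of `ℒ(·, zs)` (`mem_oracle_of_isLocalMin`).
* Relative smoothness and positive definiteness of the Hessians make `ĥ` locally strongly convex, so
  that `φ(v) + D_ĥ(v, x) ≥ φ(zs) + κ ‖x - zs‖²` near the strong local minimum `zs`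
  (`IsStrongLocalMin.exists_add_bregman_ge`).
* `JR(zs)` is injective (`injective_id_sub`). If `JR(zs) e = 0`, then `x - p x = o(τ)` at
  `x = zs + τ e`. The envelope changes between neighbouring points of this ray by at most a multiple
  of their distance times the residual, up to second-order terms, so it rises only by `o(τ²)` along
  the ray; quadratic growth forces `e = 0`. This uses neither symmetry of the Jacobians nor second
  derivatives of a conjugate function.
* By the Dennis–Moré condition, therefore, `‖z + d - zs‖ = o(‖z - zs‖)`
  (`isLittleO_add_sub_of_dennisMore`).
* The envelope at `u = z + d` is at most `φ(zs) + D_ĥ(zs, u) = φ(zs) + O(‖u - zs‖²)`, which is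
  eventually below `φ(zs) + κ ‖z - zs‖²` and thus below the envelope at `z`
  (`eventually_add_bregman_le`): the unit stepsize is accepted.
* The incremental loop composes maps that are Lipschitz at the fixed point, so the next iterate is
  `O(‖u - zs‖) = o(‖z - zs‖)` away from `zs` (`SpiralRun.isBigO_z_succ_sub`).
-/

namespace SPIRAL

/-! ### Gradients and Bregman distances of smooth convex functions -/

section Bregman

variable {n : ℕ} {h : E n → ℝ} {x y zs : E n}

theorem inner_gradient (h : E n → ℝ) (x v : E n) : inner ℝ (gradient h x) v = fderiv ℝ h x v := by
  simp [gradient]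

theorem contDiff_one_gradient (hh : ContDiff ℝ 2 h) : ContDiff ℝ 1 (gradient h) :=
  (InnerProductSpace.toDual ℝ (E n)).symm.contDiff.comp
    (hh.fderiv_right (m := 1) (by norm_num))

theorem bregman_add {h₁ h₂ : E n → ℝ} (h₁d : Differentiable ℝ h₁) (h₂d : Differentiable ℝ h₂)
    (y x : E n) : bregman (fun z => h₁ z + h₂ z) y x = bregman h₁ y x + bregman h₂ y x := by
  simp only [bregman, inner_gradient]
  rw [fderiv_fun_add (h₁d x) (h₂d x)]
  simp only [add_apply]
  ring

theorem bregman_const_mul {h : E n → ℝ} (hd : Differentiable ℝ h) (c : ℝ) (y x : E n) :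
    bregman (fun z => c * h z) y x = c * bregman h y x := by
  simp only [bregman, inner_gradient]
  rw [fderiv_const_mul (hd x)]
  simp only [smul_apply, smul_eq_mul]
  ring

theorem bregman_sum {ι : Type*} (s : Finset ι) {h : ι → E n → ℝ}
    (hd : ∀ i, Differentiable ℝ (h i)) (y x : E n) :
    bregman (fun z => ∑ i ∈ s, h i z) y x = ∑ i ∈ s, bregman (h i) y x := by
  simp only [bregman, inner_gradient]
  rw [fderiv_fun_sum fun i _ => hd i x]
  simp [Finset.sum_sub_distrib]

@[simp] theorem bregman_self (h : E n → ℝ) (x : E n) : bregman h x x = 0 := by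
  simp [bregman]

theorem bregman_nonneg (hc : ConvexOn ℝ Set.univ h) (hd : Differentiable ℝ h) (y x : E n) :
    0 ≤ bregman h y x := by
  have hline : ConvexOn ℝ Set.univ (fun t : ℝ => h (AffineMap.lineMap x y t)) :=
    hc.comp_affineMap (AffineMap.lineMap x y)
  have hder : HasDerivAt (fun t : ℝ => h (AffineMap.lineMap x y t)) (fderiv ℝ h x (y - x)) 0 := by
    have h1 : HasDerivAt (fun t : ℝ => AffineMap.lineMap x y t) (y - x) (0 : ℝ) :=
      AffineMap.hasDerivAt_lineMap
    have h2 : HasFDerivAt h (fderiv ℝ h x) ((AffineMap.lineMap x y : ℝ →ᵃ[ℝ] E n) 0) := by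
      simpa using (hd x).hasFDerivAt
    exact h2.comp_hasDerivAt (0 : ℝ) h1
  have := hline.le_slope_of_hasDerivAt (Set.mem_univ 0) (Set.mem_univ 1) zero_lt_one hder
  simp only [slope_def_field, AffineMap.lineMap_apply_one, AffineMap.lineMap_apply_zero, sub_zero,
    div_one] at this
  rw [bregman, inner_gradient]
  linarith

/-- The sum `D_h(y, x) + D_h(x, y)` is `⟨∇h(y) - ∇h(x), y - x⟩`, and both terms are nonnegative. -/
theorem bregman_le_inner (hc : ConvexOn ℝ Set.univ h) (hd : Differentiable ℝ h) (y x : E n) :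
    bregman h y x ≤ inner ℝ (gradient h y - gradient h x) (y - x) := by
  have h1 := bregman_nonneg hc hd x y
  have h2 : inner ℝ (gradient h y) (x - y) = - inner ℝ (gradient h y) (y - x) := by
    rw [← inner_neg_right, neg_sub]
  rw [bregman, h2] at h1
  rw [bregman, inner_sub_left]
  linarith

/-- Three-point identity: the effect on `D_h(w, ·)` of moving the base point from `x` to `y`. -/
theorem bregman_sub_bregman (h : E n → ℝ) (w y x : E n) :
    bregman h w y - bregman h w x =
      bregman h x y + inner ℝ (gradient h x - gradient h y) (w - x) := by
  have h1 : w - y = (w - x) + (x - y) := by abel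
  simp only [bregman, h1, inner_add_right, inner_sub_left]
  ring

/-- Two gradient inequalities, at `x` and at the midpoint, bound the Bregman distance below by the
monotonicity of the gradient. This turns local strong monotonicity of `∇h` into quadratic growth of
`D_h` without integration. -/
theorem inner_midpoint_le_bregman (hc : ConvexOn ℝ Set.univ h) (hd : Differentiable ℝ h)
    (y x : E n) :
    inner ℝ (gradient h (midpoint ℝ x y) - gradient h x) (midpoint ℝ x y - x) ≤
      bregman h y x := by
  have h1 := bregman_nonneg hc hd y (midpoint ℝ x y)
  have h2 := bregman_nonneg hc hd (midpoint ℝ x y) x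
  have e1 : y - midpoint ℝ x y = midpoint ℝ x y - x := by
    rw [right_sub_midpoint, midpoint_sub_left]
  have e2 : y - x = (midpoint ℝ x y - x) + (midpoint ℝ x y - x) := by
    nth_rewrite 1 [← e1]; abel
  rw [bregman, e1] at h1
  rw [bregman] at h2
  rw [bregman, e2, inner_add_right, inner_sub_left]
  linarith

theorem exists_gradient_lipschitz (hh : ContDiff ℝ 2 h) (zs : E n) :
    ∃ K : ℝ, 0 ≤ K ∧ ∃ r > 0, ∀ x ∈ Metric.ball zs r, ∀ y ∈ Metric.ball zs r,
      ‖gradient h x - gradient h y‖ ≤ K * ‖x - y‖ := by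
  obtain ⟨K, s, hs, hK⟩ := ((contDiff_one_gradient hh).contDiffAt (x := zs)).exists_lipschitzOnWith
  obtain ⟨r, hr, hrs⟩ := Metric.mem_nhds_iff.1 hs
  refine ⟨K, K.2, r, hr, fun x hx y hy => ?_⟩
  simpa [dist_eq_norm] using hK.dist_le_mul x (hrs hx) y (hrs hy)

theorem exists_pos_le_inner_apply (B : E n →L[ℝ] E n) (hB : ∀ v, v ≠ 0 → 0 < inner ℝ (B v) v) :
    ∃ μ : ℝ, 0 < μ ∧ ∀ v, μ * ‖v‖ ^ 2 ≤ inner ℝ (B v) v := by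
  have hcont : ContinuousOn (fun v => inner ℝ (B v) v : E n → ℝ) (Metric.sphere 0 1) := by fun_prop
  rcases (Metric.sphere (0 : E n) 1).eq_empty_or_nonempty with hemp | hne
  · refine ⟨1, one_pos, fun v => ?_⟩
    by_cases hv : v = 0
    · simp [hv]
    · have : ‖v‖⁻¹ • v ∈ Metric.sphere (0 : E n) 1 := by
        simp [norm_smul, hv]
      simp [hemp] at this
  · obtain ⟨v₀, hv₀, hmin⟩ := (isCompact_sphere (0 : E n) 1).exists_isMinOn hne hcont
    have hv₀' : v₀ ≠ 0 := by
      rintro rfl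
      simp at hv₀
    refine ⟨_, hB v₀ hv₀', fun v => ?_⟩
    by_cases hv : v = 0
    · simp [hv]
    · have hmem : ‖v‖⁻¹ • v ∈ Metric.sphere (0 : E n) 1 := by
        simp [norm_smul, hv]
      have h1 : inner ℝ (B v₀) v₀ ≤ inner ℝ (B (‖v‖⁻¹ • v)) (‖v‖⁻¹ • v) := hmin hmem
      rw [map_smul, real_inner_smul_left, real_inner_smul_right, ← mul_assoc] at h1
      have hpos : 0 < ‖v‖ := norm_pos_iff.2 hv
      calc _ ≤ (‖v‖⁻¹ * ‖v‖⁻¹ * inner ℝ (B v) v) * ‖v‖ ^ 2 := by gcongr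
        _ = _ := by field_simp

/-- A convex `C²` function with positive definite Hessian is locally strongly convex, uniformly in
both arguments of its Bregman distance. -/
theorem exists_bregman_ge (hc : ConvexOn ℝ Set.univ h) (hh : ContDiff ℝ 2 h)
    (hpos : HessianPosDef h) (zs : E n) :
    ∃ μ : ℝ, 0 < μ ∧ ∃ r > 0, ∀ x ∈ Metric.ball zs r, ∀ y ∈ Metric.ball zs r,
      μ * ‖y - x‖ ^ 2 ≤ bregman h y x := by
  obtain ⟨μ, hμ, hB⟩ := exists_pos_le_inner_apply _ (hpos zs)
  have hstrict : HasStrictFDerivAt (gradient h) (fderiv ℝ (gradient h) zs) zs :=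
    (contDiff_one_gradient hh).contDiffAt.hasStrictFDerivAt (by simp)
  have hev := hstrict.isLittleO.def (half_pos hμ)
  obtain ⟨r, hr, hball⟩ := Metric.eventually_nhds_iff_ball.1 hev
  refine ⟨μ / 8, by positivity, r, hr, fun x hx y hy => ?_⟩
  set m := midpoint ℝ x y with hm_def
  have hm : m ∈ Metric.ball zs r := (convex_ball zs r).midpoint_mem hx hy
  have hq := hball (m, x) (by rw [← ball_prod_same]; exact ⟨hm, hx⟩)
  simp only at hq
  have hmx : ‖m - x‖ = ‖y - x‖ / 2 := by
    rw [hm_def, midpoint_sub_left, norm_smul]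
    norm_num; ring
  have hsplit : inner ℝ (gradient h m - gradient h x) (m - x) =
      inner ℝ (fderiv ℝ (gradient h) zs (m - x)) (m - x) +
        inner ℝ (gradient h m - gradient h x - fderiv ℝ (gradient h) zs (m - x)) (m - x) := by
    rw [← inner_add_left]; congr 1; abel
  have h3 : -(μ / 2 * ‖m - x‖ ^ 2) ≤
      inner ℝ (gradient h m - gradient h x - fderiv ℝ (gradient h) zs (m - x)) (m - x) := by
    have := (abs_le.1 (abs_real_inner_le_norm
      (gradient h m - gradient h x - fderiv ℝ (gradient h) zs (m - x)) (m - x))).1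
    nlinarith [mul_le_mul_of_nonneg_right hq (norm_nonneg (m - x))]
  have h4 := inner_midpoint_le_bregman hc (hh.differentiable (by norm_num)) y x
  have h5 := hB (m - x)
  rw [← hm_def, hsplit] at h4
  rw [hmx] at h3 h5
  nlinarith

/-- A locally Lipschitz gradient bounds the Bregman distance by the squared distance. -/
theorem bregman_le_of_lipschitz (hc : ConvexOn ℝ Set.univ h) (hd : Differentiable ℝ h) {K : ℝ}
    (hK : ‖gradient h y - gradient h x‖ ≤ K * ‖y - x‖) :
    bregman h y x ≤ K * ‖y - x‖ ^ 2 := by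
  have h1 := bregman_le_inner hc hd y x
  have h2 := real_inner_le_norm (gradient h y - gradient h x) (y - x)
  nlinarith [mul_le_mul_of_nonneg_right hK (norm_nonneg (y - x))]

end Bregman

/-! ### Quadratic growth and nondegeneracy of the Bregman proximal mapping -/

section Prox

variable {n : ℕ} {φ : E n → EReal} {H : E n → ℝ} {p : E n → E n} {P : E n →L[ℝ] E n} {zs : E n}

/-- At a strong local minimum, `φ(v) + D_H(v, x)` grows quadratically in `x`, uniformly in `v`:
either `v` is far from `zs`, or `x` is far from `v`. -/
theorem IsStrongLocalMin.exists_add_bregman_ge (hmin : IsStrongLocalMin φ zs)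
    (hH : ∃ μ : ℝ, 0 < μ ∧ ∃ r > 0, ∀ x ∈ Metric.ball zs r, ∀ y ∈ Metric.ball zs r,
      μ * ‖y - x‖ ^ 2 ≤ bregman H y x) :
    ∃ κ : ℝ, 0 < κ ∧ ∃ r > 0, ∀ x ∈ Metric.ball zs r, ∀ v ∈ Metric.ball zs r,
      φ zs + ((κ * ‖x - zs‖ ^ 2 : ℝ) : EReal) ≤ φ v + (bregman H v x : EReal) := by
  obtain ⟨c, hc, hmin⟩ := hmin
  obtain ⟨μ, hμ, r₁, hr₁, hH⟩ := hH
  obtain ⟨r₂, hr₂, hmin⟩ := Metric.eventually_nhds_iff_ball.1 hmin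
  refine ⟨min μ (c / 2) / 2, by positivity, min r₁ r₂, lt_min hr₁ hr₂, fun x hx v hv => ?_⟩
  have hD := hH x (Metric.ball_subset_ball (min_le_left _ _) hx) v
    (Metric.ball_subset_ball (min_le_left _ _) hv)
  have hφ := hmin v (Metric.ball_subset_ball (min_le_right _ _) hv)
  have htri : ‖x - zs‖ ≤ ‖v - x‖ + ‖v - zs‖ := by
    have := norm_sub_le (v - zs) (v - x)
    rw [sub_sub_sub_cancel_left] at this
    linarith
  have hsq : ‖x - zs‖ ^ 2 ≤ 2 * ‖v - x‖ ^ 2 + 2 * ‖v - zs‖ ^ 2 := by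
    nlinarith [norm_nonneg (x - zs), sq_nonneg (‖v - x‖ - ‖v - zs‖)]
  have hreal : min μ (c / 2) / 2 * ‖x - zs‖ ^ 2 ≤
      c / 2 * ‖v - zs‖ ^ 2 + bregman H v x := by
    have hm : 0 ≤ min μ (c / 2) := by positivity
    nlinarith [mul_le_mul_of_nonneg_right (min_le_left μ (c / 2)) (sq_nonneg ‖v - x‖),
      mul_le_mul_of_nonneg_right (min_le_right μ (c / 2)) (sq_nonneg ‖v - zs‖)]
  calc φ zs + ((min μ (c / 2) / 2 * ‖x - zs‖ ^ 2 : ℝ) : EReal)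
      ≤ φ zs + ((c / 2 * ‖v - zs‖ ^ 2 + bregman H v x : ℝ) : EReal) := by
        gcongr
    _ = (φ zs + ((c / 2 * ‖v - zs‖ ^ 2 : ℝ) : EReal)) + (bregman H v x : EReal) := by
        rw [EReal.coe_add, add_assoc]
    _ ≤ _ := by gcongr

/-- The derivative `P` of `p` at a fixed point `zs` does not have the eigenvalue `1` if a function
`ev`, whose increments are bounded like those of the envelope `x ↦ min {φ + D_H(·, x)}` attained at
`p x`, grows quadratically at `zs`. For an eigenvector `e`, the residual `x - p x` would be `o(τ)` at
`x = zs + τ e`, and then so would be the slope of the envelope; summing its increments over a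
partition of a short segment contradicts quadratic growth. -/
theorem eq_zero_of_apply_eq_self (hc : ConvexOn ℝ Set.univ H) (hd : ContDiff ℝ 2 H)
    (hp : HasFDerivAt p P zs) (hpz : p zs = zs) {ev : E n → ℝ} {κ : ℝ} (hκ : 0 < κ)
    (hgrow : ∀ᶠ x in 𝓝 zs, ev zs + κ * ‖x - zs‖ ^ 2 ≤ ev x)
    (hincr : ∃ r > 0, ∀ a ∈ Metric.ball zs r, ∀ b ∈ Metric.ball zs r,
      ev a - ev b ≤ bregman H (p b) a - bregman H (p b) b)
    {e : E n} (he : P e = e) : e = 0 := by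
  by_contra hne
  have hepos : 0 < ‖e‖ := norm_pos_iff.2 hne
  obtain ⟨K, hK, r, hr, hlip⟩ := exists_gradient_lipschitz hd zs
  obtain ⟨r', hr', hincr⟩ := hincr
  set η := κ / (2 * (K + 1)) with hη
  have hηpos : 0 < η := by positivity
  have hres : ∀ᶠ x in 𝓝 zs, ‖p x - p zs - P (x - zs)‖ ≤ η * ‖x - zs‖ := hp.isLittleO.def hηpos
  obtain ⟨ρ, hρ, hball⟩ := Metric.eventually_nhds_iff_ball.1
    (((hgrow.and (Metric.ball_mem_nhds zs hr')).and hres).and (Metric.ball_mem_nhds zs hr))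
  set δ := ρ / (2 * ‖e‖) with hδ
  have hδpos : 0 < δ := by positivity
  obtain ⟨m, hm⟩ := exists_nat_gt (1 / η)
  have hmpos : (0 : ℝ) < m := lt_trans (by positivity) hm
  set σ := δ / m with hσ
  have hσpos : 0 < σ := by positivity
  have hmσ : m * σ = δ := by rw [hσ]; field_simp
  have hx : ∀ j : ℕ, j ≤ m → zs + (j * σ) • e ∈ Metric.ball zs ρ ∧ j * σ ≤ δ := by
    intro j hj
    have hjδ : j * σ ≤ δ := by
      rw [← hmσ]
      gcongr
    refine ⟨?_, hjδ⟩
    rw [mem_ball_iff_norm, add_sub_cancel_left, norm_smul, Real.norm_of_nonneg (by positivity)]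
    calc j * σ * ‖e‖ ≤ δ * ‖e‖ := by gcongr
      _ = ρ / 2 := by rw [hδ]; field_simp
      _ < ρ := by linarith
  have hstep : ∀ j : ℕ, j ≤ m →
      ev (zs + (j * σ) • e) ≤ ev zs + j * (K * (σ * ‖e‖) ^ 2 + K * (σ * ‖e‖) * (η * (δ * ‖e‖))) := by
    intro j
    induction j with
    | zero => intro _; simp
    | succ j ih =>
      intro hj
      obtain ⟨hb, hbδ⟩ := hx j (Nat.le_of_succ_le hj)
      obtain ⟨ha, -⟩ := hx (j + 1) hj
      obtain ⟨⟨⟨-, hbr'⟩, hresb⟩, hbr⟩ := hball _ hb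
      obtain ⟨⟨⟨-, har'⟩, -⟩, har⟩ := hball _ ha
      have ih := ih (Nat.le_of_succ_le hj)
      set b := zs + (j * σ) • e with hb_def
      set a := zs + (((j + 1 : ℕ) : ℝ) * σ) • e with ha_def
      have hba : ‖b - a‖ = σ * ‖e‖ := by
        have : b - a = -(σ • e) := by
          rw [hb_def, ha_def]; push_cast; module
        rw [this, norm_neg, norm_smul, Real.norm_of_nonneg hσpos.le]
      have hpb : ‖p b - b‖ ≤ η * (δ * ‖e‖) := by
        have e1 : b - zs = (j * σ) • e := by rw [hb_def]; abel
        have e2 : p b - p zs - P (b - zs) = p b - b := by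
          rw [e1, map_smul, he, hpz, hb_def]; abel
        rw [e2, e1, norm_smul, Real.norm_of_nonneg (by positivity)] at hresb
        refine hresb.trans ?_
        gcongr
      have h1 := hincr a har' b hbr'
      rw [bregman_sub_bregman] at h1
      have h2 := bregman_le_of_lipschitz hc (hd.differentiable (by norm_num)) (hlip b hbr a har)
      have h3 := real_inner_le_norm (gradient H b - gradient H a) (p b - b)
      have h4 : ‖gradient H b - gradient H a‖ * ‖p b - b‖ ≤
          K * (σ * ‖e‖) * (η * (δ * ‖e‖)) := by
        rw [← hba]
        exact mul_le_mul (hlip b hbr a har) hpb (norm_nonneg _) (by positivity)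
      rw [hba] at h2
      push_cast
      linarith
  have hend := hstep m le_rfl
  have hlow := (hball _ (hx m le_rfl).1).1.1.1
  rw [hmσ] at hend hlow
  rw [add_sub_cancel_left, norm_smul, Real.norm_of_nonneg hδpos.le] at hlow
  -- the accumulated increments amount to `K (1 / m + η) (δ ‖e‖)² < κ (δ ‖e‖)²`
  have hid : m * (K * (σ * ‖e‖) ^ 2 + K * (σ * ‖e‖) * (η * (δ * ‖e‖))) =
      K * (1 / m + η) * (δ * ‖e‖) ^ 2 := by
    rw [hσ]; field_simp
  have hm' : 1 / (m : ℝ) < η := by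
    rw [one_div_lt hmpos hηpos]; exact hm
  have hlt : K * (1 / m + η) < κ := by
    have hKη : (K + 1) * (2 * η) = κ := by rw [hη]; field_simp
    have : K * (1 / m + η) ≤ K * (2 * η) := by
      gcongr; linarith
    nlinarith
  have hsq : 0 < (δ * ‖e‖) ^ 2 := by positivity
  nlinarith [mul_lt_mul_of_pos_right hlt hsq]

/-- Injectivity of `I - P`, the Jacobian at `zs` of the residual of the Bregman proximal mapping
`p x = argmin {φ + D_H(·, x)}`. The quadratic growth is that of
`IsStrongLocalMin.exists_add_bregman_ge`. -/
theorem injective_id_sub (hc : ConvexOn ℝ Set.univ H) (hd : ContDiff ℝ 2 H)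
    (hp : HasFDerivAt p P zs) (hpz : p zs = zs) (hbot : ∀ x, φ x ≠ ⊥) (htop : φ zs ≠ ⊤)
    (hopt : ∀ᶠ x in 𝓝 zs, ∀ w,
      φ (p x) + (bregman H (p x) x : EReal) ≤ φ w + (bregman H w x : EReal))
    {κ : ℝ} (hκ : 0 < κ)
    (hgrow : ∃ r > 0, ∀ x ∈ Metric.ball zs r, ∀ v ∈ Metric.ball zs r,
      φ zs + ((κ * ‖x - zs‖ ^ 2 : ℝ) : EReal) ≤ φ v + (bregman H v x : EReal)) :
    Function.Injective (ContinuousLinearMap.id ℝ (E n) - P) := by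
  have hfin : ∀ᶠ x in 𝓝 zs, φ (p x) ≠ ⊤ := by
    filter_upwards [hopt] with x hx htop'
    have := hx zs
    rw [htop', EReal.top_add_coe, top_le_iff] at this
    exact (EReal.add_lt_top htop (EReal.coe_ne_top _)).ne this
  have hcoe : ∀ {w}, φ w ≠ ⊤ → φ w = ((φ w).toReal : EReal) := fun hw =>
    (EReal.coe_toReal hw (hbot _)).symm
  obtain ⟨r, hr, hgrow⟩ := hgrow
  have hpt : Tendsto p (𝓝 zs) (𝓝 zs) := by
    simpa [ContinuousAt, hpz] using hp.continuousAt
  rw [injective_iff_map_eq_zero]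
  intro e he
  have he' : P e = e := (sub_eq_zero.1 (by simpa using he)).symm
  refine eq_zero_of_apply_eq_self hc hd hp hpz
    (ev := fun x => (φ (p x)).toReal + bregman H (p x) x) hκ ?_ ?_ he'
  · filter_upwards [hfin, hpt (Metric.ball_mem_nhds zs hr), Metric.ball_mem_nhds zs hr]
      with x hx hpx hxr
    have := hgrow x hxr (p x) hpx
    rw [hcoe hx, hcoe htop] at this
    rw [hpz, bregman_self, add_zero]
    exact_mod_cast this
  · obtain ⟨ρ, hρ, hball⟩ := Metric.eventually_nhds_iff_ball.1 (hopt.and hfin)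
    refine ⟨ρ, hρ, fun a ha b hb => ?_⟩
    have := (hball a ha).1 (p b)
    rw [hcoe (hball a ha).2, hcoe (hball b hb).2] at this
    have : (φ (p a)).toReal + bregman H (p a) a ≤ (φ (p b)).toReal + bregman H (p b) a := by
      exact_mod_cast this
    linarith

/-- The upper estimate `min {φ + D_H(·, u)} ≤ φ(zs) + D_H(zs, u) = φ(zs) + O(‖u - zs‖²)` meets the
quadratic lower estimate at `x`: if `u` is much closer to `zs` than `x`, the envelope at `u` does
not exceed the envelope at `x`. -/
theorem eventually_add_bregman_le (hc : ConvexOn ℝ Set.univ H) (hd : ContDiff ℝ 2 H)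
    {κ : ℝ} (hκ : 0 < κ)
    (hgrow : ∃ r > 0, ∀ x ∈ Metric.ball zs r, ∀ v ∈ Metric.ball zs r,
      φ zs + ((κ * ‖x - zs‖ ^ 2 : ℝ) : EReal) ≤ φ v + (bregman H v x : EReal))
    {z v u : ℕ → E n} (hz : Tendsto z atTop (𝓝 zs)) (hv : Tendsto v atTop (𝓝 zs))
    (hu : (fun k => u k - zs) =o[atTop] fun k => z k - zs) (hut : Tendsto u atTop (𝓝 zs)) :
    ∀ᶠ k in atTop,
      φ zs + (bregman H zs (u k) : EReal) ≤ φ (v k) + (bregman H (v k) (z k) : EReal) := by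
  obtain ⟨K, hK, r, hr, hlip⟩ := exists_gradient_lipschitz hd zs
  obtain ⟨r', hr', hgrow⟩ := hgrow
  have hε : 0 < Real.sqrt (κ / (K + 1)) := by positivity
  filter_upwards [hu.def hε, hut (Metric.ball_mem_nhds zs hr), hz (Metric.ball_mem_nhds zs hr'),
    hv (Metric.ball_mem_nhds zs hr')] with k hk huk hzk hvk
  refine le_trans ?_ (hgrow (z k) hzk (v k) hvk)
  gcongr
  have h1 := bregman_le_of_lipschitz hc (hd.differentiable (by norm_num))
    (hlip zs (Metric.mem_ball_self hr) (u k) huk)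
  have h2 : ‖u k - zs‖ ^ 2 ≤ κ / (K + 1) * ‖z k - zs‖ ^ 2 := by
    calc _ ≤ (Real.sqrt (κ / (K + 1)) * ‖z k - zs‖) ^ 2 := by gcongr
      _ = _ := by rw [mul_pow, Real.sq_sqrt (by positivity)]
  rw [norm_sub_rev] at h1
  calc bregman H zs (u k) ≤ (K + 1) * ‖u k - zs‖ ^ 2 := by nlinarith [sq_nonneg ‖u k - zs‖]
    _ ≤ (K + 1) * (κ / (K + 1) * ‖z k - zs‖ ^ 2) := by gcongr
    _ = κ * ‖z k - zs‖ ^ 2 := by field_simp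

end Prox

/-! ### Quasi-Newton directions -/

/-- Dennis–Moré argument: a direction `d` that asymptotically solves the Newton equation
`r + J d = 0` of a residual `r` with injective Jacobian `J` makes `z + d` superlinearly better
than `z`. -/
theorem isLittleO_add_sub_of_dennisMore {n : ℕ} {J : E n →L[ℝ] E n} (hJ : Function.Injective J)
    {R : E n → E n} {zs : E n} (hR : HasFDerivAt R J zs) (hR0 : R zs = 0) {z d : ℕ → E n}
    (hz : Tendsto z atTop (𝓝 zs)) (hDM : (fun k => R (z k) + J (d k)) =o[atTop] d) :
    (fun k => z k + d k - zs) =o[atTop] fun k => z k - zs := by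
  obtain ⟨C, hCpos, hC⟩ := (LinearMap.injective_iff_antilipschitz (J : E n →ₗ[ℝ] E n)).1 hJ
  have hCle : ∀ w, ‖w‖ ≤ C * ‖J w‖ := fun w => by
    simpa using hC.le_mul_dist w 0
  have hRz := hR.isLittleO.comp_tendsto hz
  have hCpos' : (0 : ℝ) < C := hCpos
  refine IsLittleO.of_bound fun ε hε => ?_
  set θ := min (1 / 2) (ε / 4) with hθ
  have hθpos : 0 < θ := by positivity
  have hc : 0 < θ / C := by positivity
  filter_upwards [hDM.def hc, hRz.def hc] with k h1 h2
  simp only [Function.comp_apply, hR0, sub_zero] at h2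
  set w := z k + d k - zs with hw
  have hJw : J w = (R (z k) + J (d k)) - (R (z k) - J (z k - zs)) := by
    rw [hw, show z k + d k - zs = d k + (z k - zs) by abel, map_add]; abel
  have h3 : ‖J w‖ ≤ θ / C * ‖d k‖ + θ / C * ‖z k - zs‖ := by
    rw [hJw]
    exact (norm_sub_le _ _).trans (add_le_add h1 h2)
  have h4 : ‖w‖ ≤ θ * ‖d k‖ + θ * ‖z k - zs‖ := by
    calc ‖w‖ ≤ C * ‖J w‖ := hCle w
      _ ≤ C * (θ / C * ‖d k‖ + θ / C * ‖z k - zs‖) := by gcongr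
      _ = _ := by field_simp
  have h5 : ‖d k‖ ≤ ‖w‖ + ‖z k - zs‖ := by
    have := norm_sub_le w (z k - zs)
    rwa [show w - (z k - zs) = d k by rw [hw]; abel] at this
  have h6 : θ ≤ 1 / 2 := min_le_left _ _
  have h7 : θ ≤ ε / 4 := min_le_right _ _
  nlinarith [mul_le_mul_of_nonneg_right h6 (norm_nonneg w),
    mul_le_mul_of_nonneg_right h7 (norm_nonneg (z k - zs)),
    mul_le_mul_of_nonneg_left h5 hθpos.le]

/-! ### The oracle as a Bregman proximal mapping -/

section Oracle

variable {n N : ℕ} {f h : Fin N → E n → ℝ} {g : E n → EReal} {L γ : Fin N → ℝ}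

/-- Up to a constant, the objective of the oracle at `∇ĥ(x)` is `ℒ(·, x)`. -/
theorem lyapunov_eq (y x : E n) :
    lyapunov f h g γ y x =
      (g y + (((∑ i, (1 / γ i) * h i y) - inner ℝ (gradient (hhat f h γ) x) y : ℝ) : EReal)) +
        ((inner ℝ (gradient (hhat f h γ) x) x - hhat f h γ x : ℝ) : EReal) := by
  have key : (1 / (N : ℝ)) * ∑ i, f i y + bregman (hhat f h γ) y x =
      ((∑ i, (1 / γ i) * h i y) - inner ℝ (gradient (hhat f h γ) x) y) +
        (inner ℝ (gradient (hhat f h γ) x) x - hhat f h γ x) := by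
    have e : hhat f h γ y = (∑ i, (1 / γ i) * h i y) - (1 / (N : ℝ)) * ∑ i, f i y := by
      simp [hhat, hhatI, Finset.sum_sub_distrib, Finset.mul_sum]
    rw [bregman, inner_sub_right, e]
    ring
  rw [lyapunov, cost, add_comm _ (g y), add_assoc, add_assoc, ← EReal.coe_add, ← EReal.coe_add, key]

theorem mem_oracle_iff {w x : E n} :
    w ∈ oracle h g γ (gradient (hhat f h γ) x) ↔
      ∀ y, lyapunov f h g γ w x ≤ lyapunov f h g γ y x := by
  refine forall_congr' fun y => ?_
  rw [lyapunov_eq, lyapunov_eq]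
  refine ⟨fun hle => by gcongr, fun hle => ?_⟩
  by_contra! hlt
  exact (EReal.add_lt_add_right_coe hlt _).not_ge hle

theorem ne_top_of_mem_oracle (hg : IsProper g) {s w : E n} (hw : w ∈ oracle h g γ s) :
    g w ≠ ⊤ := by
  obtain ⟨x, hx⟩ := hg.2
  intro htop
  have : g w + _ ≤ g x + _ := hw x
  rw [htop, EReal.top_add_coe, top_le_iff] at this
  exact (EReal.add_lt_top hx (EReal.coe_ne_top _)).ne this

theorem cost_ne_bot (hg : IsProper g) (x : E n) : cost f g x ≠ ⊥ := by
  rw [cost, Ne, EReal.add_eq_bot_iff, not_or]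
  exact ⟨EReal.coe_ne_bot _, hg.1 x⟩

theorem cost_ne_top {x : E n} (hx : g x ≠ ⊤) : cost f g x ≠ ⊤ :=
  (EReal.add_lt_top (EReal.coe_ne_top _) hx).ne

/-! ### Convexity and smoothness of `ĥ` -/

theorem hhatI_eq (i : Fin N) (x : E n) :
    hhatI f h γ i x =
      (1 / γ i - L i / N) * h i x + (1 / (N : ℝ)) * (L i * h i x - f i x) := by
  rw [hhatI]; ring

theorem one_div_sub_pos (hN : 0 < N) {i : Fin N} (hγ : 0 < γ i ∧ γ i * L i < N) :
    0 < 1 / γ i - L i / N := by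
  have hN' : (0 : ℝ) < N := Nat.cast_pos.2 hN
  rw [sub_pos, div_lt_div_iff₀ hN' hγ.1]
  linarith [hγ.2]

theorem convexOn_hhatI (hN : 0 < N) {i : Fin N} (hh : IsDGF (h i))
    (hf : IsRelSmooth (L i) (h i) (f i)) (hγ : 0 < γ i ∧ γ i * L i < N) :
    ConvexOn ℝ Set.univ (hhatI f h γ i) := by
  have h1 := hh.1.convexOn.smul (one_div_sub_pos hN hγ).le
  have h2 := hf.2.2.smul (c := 1 / (N : ℝ)) (by positivity)
  exact (h1.add h2).congr fun x _ => by simpa using (hhatI_eq i x).symm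

theorem convexOn_hhat (hN : 0 < N) (hh : ∀ i, IsDGF (h i))
    (hf : ∀ i, IsRelSmooth (L i) (h i) (f i)) (hγ : ∀ i, 0 < γ i ∧ γ i * L i < N) :
    ConvexOn ℝ Set.univ (hhat f h γ) := by
  refine ⟨convex_univ, fun x hx y hy a b ha hb hab => ?_⟩
  simp only [hhat, Finset.smul_sum, ← Finset.sum_add_distrib]
  exact Finset.sum_le_sum fun i _ => (convexOn_hhatI hN (hh i) (hf i) (hγ i)).2 hx hy ha hb hab

theorem contDiff_hhatI {i : Fin N} (hf2 : ContDiff ℝ 2 (f i)) (hh2 : ContDiff ℝ 2 (h i)) :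
    ContDiff ℝ 2 (hhatI f h γ i) :=
  (contDiff_const.mul hh2).sub (contDiff_const.mul hf2)

theorem contDiff_hhat (hf2 : ∀ i, ContDiff ℝ 2 (f i)) (hh2 : ∀ i, ContDiff ℝ 2 (h i)) :
    ContDiff ℝ 2 (hhat f h γ) :=
  ContDiff.sum fun i _ => contDiff_hhatI (hf2 i) (hh2 i)

/-- Relative smoothness of `f i` leaves the share `1 / γ_i - L_i / N` of `D_{h_i}` in `D_ĥ`. -/
theorem mul_bregman_le_bregman_hhat (hN : 0 < N) (hh : ∀ i, IsDGF (h i))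
    (hf : ∀ i, IsRelSmooth (L i) (h i) (f i)) (hγ : ∀ i, 0 < γ i ∧ γ i * L i < N)
    (hf2 : ∀ i, ContDiff ℝ 2 (f i)) (hh2 : ∀ i, ContDiff ℝ 2 (h i)) (i : Fin N) (y x : E n) :
    (1 / γ i - L i / N) * bregman (h i) y x ≤ bregman (hhat f h γ) y x := by
  have hfd : ∀ i, Differentiable ℝ (f i) := fun i => (hf2 i).differentiable (by norm_num)
  have hhd : ∀ i, Differentiable ℝ (h i) := fun i => (hh2 i).differentiable (by norm_num)
  have hId : ∀ i, Differentiable ℝ (hhatI f h γ i) := fun i =>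
    (contDiff_hhatI (hf2 i) (hh2 i)).differentiable (by norm_num)
  have hd : Differentiable ℝ fun z => L i * h i z - f i z := ((hhd i).const_mul _).sub (hfd i)
  have h1 : bregman (hhatI f h γ i) y x = (1 / γ i - L i / N) * bregman (h i) y x +
      (1 / (N : ℝ)) * bregman (fun z => L i * h i z - f i z) y x := by
    rw [← bregman_const_mul (hhd i), ← bregman_const_mul hd,
      ← bregman_add ((hhd i).const_mul _) (hd.const_mul _)]
    exact congrArg (fun F => bregman F y x) (funext (hhatI_eq i))
  have h2 := bregman_nonneg (hf i).2.2 hd y x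
  have h3 : bregman (hhatI f h γ i) y x ≤ bregman (hhat f h γ) y x := by
    have : bregman (hhat f h γ) y x = ∑ i, bregman (hhatI f h γ i) y x :=
      bregman_sum Finset.univ hId y x
    rw [this]
    exact Finset.single_le_sum (f := fun i => bregman (hhatI f h γ i) y x) (fun j _ =>
      bregman_nonneg (convexOn_hhatI hN (hh j) (hf j) (hγ j)) (hId j) y x) (Finset.mem_univ i)
  have h4 : 0 ≤ (1 / (N : ℝ)) * bregman (fun z => L i * h i z - f i z) y x := by positivity
  linarith

theorem convexOn_sum_dgf (hh : ∀ i, IsDGF (h i)) (hγ : ∀ i, 0 < γ i ∧ γ i * L i < N) :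
    ConvexOn ℝ Set.univ fun w => ∑ i, (1 / γ i) * h i w := by
  refine ⟨convex_univ, fun x hx y hy a b ha hb hab => ?_⟩
  simp only [Finset.smul_sum, ← Finset.sum_add_distrib]
  refine Finset.sum_le_sum fun i _ => ?_
  have := ((hh i).1.convexOn.smul (one_div_nonneg.2 (hγ i).1.le)).2 hx hy ha hb hab
  simpa using this

/-! ### Local minima are fixed points of the oracle -/

/-- A local minimizer `zs` of `φ` locally minimizes `φ + D_ĥ(·, zs)`, which is the convex objective
of the oracle at `∇ĥ(zs)`; hence it minimizes that objective globally. -/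
theorem mem_oracle_of_isLocalMin (hg : IsProper g) (hgc : IsConvexFun g)
    (hH : ConvexOn ℝ Set.univ fun w => ∑ i, (1 / γ i) * h i w)
    (hc : ConvexOn ℝ Set.univ (hhat f h γ)) (hd : Differentiable ℝ (hhat f h γ)) {zs : E n}
    (hzs : g zs ≠ ⊤) (hmin : IsLocalMin (cost f g) zs) :
    zs ∈ oracle h g γ (gradient (hhat f h γ) zs) := by
  have hloc : ∀ᶠ w in 𝓝 zs, lyapunov f h g γ zs zs ≤ lyapunov f h g γ w zs := by
    filter_upwards [hmin] with w hw
    have := bregman_nonneg hc hd w zs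
    rw [lyapunov, lyapunov, bregman_self]
    gcongr
  simp_rw [lyapunov_eq] at hloc
  intro w
  by_contra! hlt
  set s := gradient (hhat f h γ) zs
  set a : E n → ℝ := fun w => (∑ i, (1 / γ i) * h i w) - inner ℝ s w with ha
  have hac : ConvexOn ℝ Set.univ a :=
    hH.sub ((innerSL ℝ s).toLinearMap.concaveOn convex_univ)
  change g w + (a w : EReal) < g zs + (a zs : EReal) at hlt
  have hw : g w ≠ ⊤ := by
    intro htop
    rw [htop, EReal.top_add_coe] at hlt
    exact not_top_lt hlt
  have e0 := EReal.coe_toReal hzs (hg.1 zs)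
  have e1 := EReal.coe_toReal hw (hg.1 w)
  set b := (g zs).toReal
  set b' := (g w).toReal
  rw [← e0, ← e1] at hlt
  have hlt' : b' + a w < b + a zs := by exact_mod_cast hlt
  have htend : Tendsto (fun t : ℝ => (1 - t) • zs + t • w) (𝓝[>] 0) (𝓝 zs) := by
    have : Continuous fun t : ℝ => (1 - t) • zs + t • w := by fun_prop
    simpa using (this.tendsto 0).mono_left nhdsWithin_le_nhds
  have hsmall : ∀ᶠ t : ℝ in 𝓝[>] 0, t < 1 :=
    nhdsWithin_le_nhds (Iio_mem_nhds one_pos)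
  obtain ⟨t, ⟨hle, ht1⟩, ht0⟩ :=
    (((htend.eventually hloc).and hsmall).and self_mem_nhdsWithin).exists
  have ht0 : 0 < t := ht0
  have hgt : g ((1 - t) • zs + t • w) ≤ (((1 - t) * b + t * b' : ℝ) : EReal) := by
    have := hgc (x := (zs, b)) (y := (w, b')) (by simp [e0]) (by simp [e1])
      (sub_nonneg.2 ht1.le) ht0.le (by ring)
    simpa using this
  have hat : a ((1 - t) • zs + t • w) ≤ (1 - t) * a zs + t * a w := by
    simpa using hac.2 (Set.mem_univ zs) (Set.mem_univ w) (sub_nonneg.2 ht1.le) ht0.le (by ring)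
  have hlt2 : g ((1 - t) • zs + t • w) + (a ((1 - t) • zs + t • w) : EReal) <
      g zs + (a zs : EReal) := by
    calc _ ≤ (((1 - t) * b + t * b' : ℝ) : EReal) + (((1 - t) * a zs + t * a w : ℝ) : EReal) := by
          gcongr
      _ < _ := by
          rw [← e0, ← EReal.coe_add, ← EReal.coe_add, EReal.coe_lt_coe_iff]
          nlinarith
  exact (EReal.add_lt_add_right_coe hlt2 _).not_ge hle

end Oracle

/-! ### The incremental loop -/

/-- A finite family of maps, each Lipschitz at `zs`, is so along any choice of members. -/
theorem isBigO_sub_of_forall {ι V W : Type*} [Fintype ι] [NormedAddCommGroup V]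
    [NormedAddCommGroup W] {G : ι → V → W} {zs : V}
    (hG : ∀ i, (fun x => G i x - G i zs) =O[𝓝 zs] fun x => x - zs) {x : ℕ → V}
    (hx : Tendsto x atTop (𝓝 zs)) (i : ℕ → ι) :
    (fun k => G (i k) (x k) - G (i k) zs) =O[atTop] fun k => x k - zs := by
  choose C hC using fun i => (hG i).bound
  refine IsBigO.of_bound (∑ j, |C j|) ?_
  filter_upwards [hx.eventually (eventually_all.2 hC)] with k hk
  refine (hk (i k)).trans ?_
  gcongr
  exact (le_abs_self _).trans
    (Finset.single_le_sum (f := fun j => |C j|) (fun _ _ => abs_nonneg _) (Finset.mem_univ (i k)))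

theorem tendsto_of_isBigO_sub {V W : Type*} [NormedAddCommGroup V] [NormedAddCommGroup W]
    {x : ℕ → V} {y : ℕ → W} {a : V} {b : W} (h : (fun k => x k - a) =O[atTop] fun k => y k - b)
    (hy : Tendsto y atTop (𝓝 b)) : Tendsto x atTop (𝓝 a) :=
  tendsto_sub_nhds_zero_iff.1 (h.trans_tendsto (tendsto_sub_nhds_zero_iff.2 hy))

namespace SpiralRun

variable {n N : ℕ} {f h : Fin N → E n → ℝ} {g : E n → EReal} {γ : Fin N → ℝ} {β : ℝ}

/-- The accepted point `u k` of the linesearch. -/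
def u (run : SpiralRun f h g γ β) (k : ℕ) : E n :=
  trialPoint (run.z k) (run.v k) (run.d k) (β ^ run.backtracks k)

/-- One outer iteration is Lipschitz at the fixed point: the incremental loop loses only a constant
factor on the distance of `u k` to `zs`. -/
theorem isBigO_z_succ_sub (run : SpiralRun f h g γ β) {zs : E n} {t : E n → E n}
    (ht : ∀ᶠ s in 𝓝 (gradient (hhat f h γ) zs), oracle h g γ s = {t s})
    (htd : DifferentiableAt ℝ t (gradient (hhat f h γ) zs))
    (htzs : t (gradient (hhat f h γ) zs) = zs)
    (hG : Differentiable ℝ (gradient (hhat f h γ)))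
    (hGI : ∀ i, Differentiable ℝ (gradient (hhatI f h γ i)))
    (hu : Tendsto run.u atTop (𝓝 zs)) :
    (fun k => run.z (k + 1) - zs) =O[atTop] fun k => run.u k - zs := by
  set sbar := gradient (hhat f h γ) zs with hsbar
  have horacle : ∀ {x : ℕ → E n} {w : ℕ → E n}, (∀ k, w k ∈ oracle h g γ (x k)) →
      ((fun k => x k - sbar) =O[atTop] fun k => run.u k - zs) →
      (fun k => w k - zs) =O[atTop] fun k => run.u k - zs := by
    intro x w hw hx
    have hxt := tendsto_of_isBigO_sub hx hu
    have h1 := (htd.isBigO_sub.comp_tendsto hxt).trans hx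
    refine h1.congr' ?_ EventuallyEq.rfl
    filter_upwards [hxt.eventually ht] with k hk
    have : w k = t (x k) := by simpa [hk] using hw k
    simp [this, htzs]
  have hloop : ∀ j ≤ N, (fun k => run.sIn k j - sbar) =O[atTop] fun k => run.u k - zs := by
    intro j
    induction j with
    | zero =>
      intro _
      simp only [run.sIn_zero]
      exact (hG zs).isBigO_sub.comp_tendsto hu
    | succ j ih =>
      intro hj
      have ih := ih (Nat.le_of_succ_le hj)
      have hz := horacle (fun k => run.ztilde_mem k ⟨j, hj⟩) ih
      have hstep : ∀ {x : ℕ → E n}, ((fun k => x k - zs) =O[atTop] fun k => run.u k - zs) →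
          (fun k => gradient (hhatI f h γ (run.sweep k ⟨j, hj⟩)) (x k) -
            gradient (hhatI f h γ (run.sweep k ⟨j, hj⟩)) zs) =O[atTop] fun k => run.u k - zs :=
        fun hx => (isBigO_sub_of_forall (G := fun i => gradient (hhatI f h γ i))
          (fun i => (hGI i zs).isBigO_sub) (tendsto_of_isBigO_sub hx hu) _).trans hx
      refine (ih.add ((hstep hz).sub (hstep (isBigO_refl _ _)))).congr_left fun k => ?_
      have := run.sIn_succ k ⟨j, hj⟩
      simp only at this
      rw [this, u]
      abel
  refine horacle (fun k => run.z_mem (k + 1)) ?_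
  simpa only [run.s_succ] using hloop N le_rfl

/-- Since the oracle minimizes `ℒ(·, z + d)`, any witness `w` of sufficient decrease at the unit trial
point `z + d` makes the linesearch accept it at once. -/
theorem backtracks_eq_zero (run : SpiralRun f h g γ β) {k : ℕ} {w : E n}
    (hw : lyapunov f h g γ w (run.z k + run.d k) ≤ lyapunov f h g γ (run.v k) (run.z k)) :
    run.backtracks k = 0 := by
  by_contra hne
  have h1 := run.rejected k 0 (Nat.pos_of_ne_zero hne)
  have h2 := run.y_mem k 0 (Nat.zero_le _)
  have e : trialPoint (run.z k) (run.v k) (run.d k) (β ^ 0) = run.z k + run.d k := by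
    simp [trialPoint]
  rw [e] at h1 h2
  exact (h1.trans_le (mem_oracle_iff.1 h2 w)).not_ge hw

end SpiralRun

end SPIRAL

theorem mainTheorem3 {n N : ℕ} (hN : 0 < N)
    (f h : Fin N → SPIRAL.E n → ℝ) (g : SPIRAL.E n → EReal)
    (L γ : Fin N → ℝ) (β : ℝ)
    -- basic assumptions
    (hh : ∀ i, SPIRAL.IsDGF (h i))
    (hf : ∀ i, SPIRAL.IsRelSmooth (L i) (h i) (f i))
    (hg_proper : SPIRAL.IsProper g) (hg_lsc : LowerSemicontinuous g)
    (hargmin : (SPIRAL.argminSet (SPIRAL.cost f g)).Nonempty)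
    -- convexity of `g` and second-order smoothness
    (hg_convex : SPIRAL.IsConvexFun g)
    (hf2 : ∀ i, ContDiff ℝ 2 (f i)) (hh2 : ∀ i, ContDiff ℝ 2 (h i))
    (hh_pos : ∀ i, SPIRAL.HessianPosDef (h i))
    -- parameters of the algorithm: `β ∈ (0, 1)` and `γ_i ∈ (0, N / L_i)`
    (hβ : 0 < β ∧ β < 1) (hγ : ∀ i, 0 < γ i ∧ γ i * L i < N)
    -- the iterates, their limit, the directions, the oracle
    (run : SPIRAL.SpiralRun f h g γ β) (zs : SPIRAL.E n)
    (hlim : Tendsto run.z atTop (𝓝 zs))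
    (hmin : SPIRAL.IsStrongLocalMin (SPIRAL.cost f g) zs)
    (hDM : SPIRAL.DennisMore f h g γ run.z run.d zs)
    (hT : SPIRAL.IsStrictlyDifferentiableAt (SPIRAL.oracle h g γ)
      (gradient (SPIRAL.hhat f h γ) zs)) :
    (∀ᶠ k in atTop, run.τ k = 1) ∧ SPIRAL.ConvergesSuperlinearly run.z zs := by
  open SPIRAL in
  obtain ⟨t, A, ht, htA⟩ := hT
  have hc : ConvexOn ℝ Set.univ (hhat f h γ) := convexOn_hhat hN hh hf hγ
  have hC2 : ContDiff ℝ 2 (hhat f h γ) := contDiff_hhat hf2 hh2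
  have hGd : Differentiable ℝ (gradient (hhat f h γ)) :=
    (contDiff_one_gradient hC2).differentiable (by norm_num)
  have hGId : ∀ i, Differentiable ℝ (gradient (hhatI f h γ i)) := fun i =>
    (contDiff_one_gradient (contDiff_hhatI (hf2 i) (hh2 i))).differentiable (by norm_num)
  -- `φ(zs)` is finite because the iterates, which are finite points, approach `zs`
  have hgzs : g zs ≠ ⊤ := by
    obtain ⟨c, -, hev⟩ := hmin
    obtain ⟨k, hk⟩ := (hlim.eventually hev).exists
    intro htop
    have hφ : cost f g zs = ⊤ := by rw [cost, htop, EReal.coe_add_top]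
    rw [hφ, EReal.top_add_coe, top_le_iff] at hk
    exact cost_ne_top (ne_top_of_mem_oracle hg_proper (run.z_mem k)) hk
  have hlocal : IsLocalMin (cost f g) zs := by
    obtain ⟨c, hcpos, hev⟩ := hmin
    filter_upwards [hev] with x hx
    refine le_trans (le_add_of_nonneg_right ?_) hx
    exact_mod_cast (by positivity : 0 ≤ c / 2 * ‖x - zs‖ ^ 2)
  have htzs : t (gradient (hhat f h γ) zs) = zs := by
    have := mem_oracle_of_isLocalMin hg_proper hg_convex (convexOn_sum_dgf hh hγ) hc
      (hC2.differentiable (by norm_num)) hgzs hlocal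
    rw [ht.self_of_nhds] at this
    exact this.symm
  -- the Bregman proximal mapping `p = T ∘ ∇ĥ` and its residual near `zs`
  set p : E n → E n := fun x => t (gradient (hhat f h γ) x) with hp_def
  set P : E n →L[ℝ] E n := A.comp (fderiv ℝ (gradient (hhat f h γ)) zs)
  have hp : HasFDerivAt p P zs := htA.hasFDerivAt.comp zs (hGd zs).hasFDerivAt
  have hsingle : ∀ᶠ x in 𝓝 zs, oracle h g γ (gradient (hhat f h γ) x) = {p x} :=
    (hGd zs).continuousAt.eventually ht
  have hopt : ∀ᶠ x in 𝓝 zs, ∀ w, cost f g (p x) + (bregman (hhat f h γ) (p x) x : EReal) ≤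
      cost f g w + (bregman (hhat f h γ) w x : EReal) := by
    filter_upwards [hsingle] with x hx
    exact mem_oracle_iff.1 (hx ▸ Set.mem_singleton (p x))
  have hR : HasFDerivAt (fun x => x - p x) (ContinuousLinearMap.id ℝ (E n) - P) zs :=
    (hasFDerivAt_id zs).sub hp
  have hres : ∀ᶠ x in 𝓝 zs, residual f h g γ x = {x - p x} := by
    filter_upwards [hsingle] with x hx
    ext r
    simp [SPIRAL.residual, hx]
  have hJac : jacobian (residual f h g γ) zs = ContinuousLinearMap.id ℝ (E n) - P :=
    HasJacobianAt.jacobian_eq ⟨_, hres, hR⟩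
  -- quadratic growth; any single `h i` provides the local strong convexity of `ĥ`
  obtain ⟨κ, hκ, hgrow⟩ := hmin.exists_add_bregman_ge (H := hhat f h γ) <| by
    set i : Fin N := ⟨0, hN⟩
    obtain ⟨μ, hμ, r, hr, hball⟩ := exists_bregman_ge (hh i).1.convexOn (hh2 i) (hh_pos i) zs
    have ha := one_div_sub_pos hN (hγ i)
    refine ⟨(1 / γ i - L i / N) * μ, by positivity, r, hr, fun x hx y hy => ?_⟩
    rw [mul_assoc]
    exact (mul_le_mul_of_nonneg_left (hball x hx y hy) ha.le).trans
      (mul_bregman_le_bregman_hhat hN hh hf hγ hf2 hh2 i y x)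
  have hinj := injective_id_sub hc hC2 hp htzs (cost_ne_bot hg_proper) (cost_ne_top hgzs) hopt hκ
    hgrow
  have hstep : (fun k => run.z k + run.d k - zs) =o[atTop] fun k => run.z k - zs := by
    refine isLittleO_add_sub_of_dennisMore hinj hR (by simp [hp_def, htzs]) hlim ?_
    obtain ⟨r, hr, hDM⟩ := hDM
    refine hDM.congr' ?_ EventuallyEq.rfl
    filter_upwards [hlim.eventually hres] with k hk
    have : r k = run.z k - p (run.z k) := by simpa [hk] using hr k
    rw [this, hJac]
  have hunit : Tendsto (fun k => run.z k + run.d k) atTop (𝓝 zs) :=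
    tendsto_of_isBigO_sub hstep.isBigO hlim
  have hv : Tendsto run.v atTop (𝓝 zs) := by
    have hpz : Tendsto (fun k => p (run.z k)) atTop (𝓝 zs) := by
      have := hp.continuousAt.tendsto.comp hlim
      rwa [show p zs = zs from htzs] at this
    refine hpz.congr' ?_
    filter_upwards [hlim.eventually hsingle] with k hk
    exact (by simpa [hk] using run.v_mem k : run.v k = p (run.z k)).symm
  have hback : ∀ᶠ k in atTop, run.backtracks k = 0 := by
    filter_upwards [eventually_add_bregman_le hc hC2 hκ hgrow hlim hv hstep hunit] with k hk
    exact run.backtracks_eq_zero hk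
  have hu : run.u =ᶠ[atTop] fun k => run.z k + run.d k := by
    filter_upwards [hback] with k hk
    simp [SpiralRun.u, hk, trialPoint]
  have hrate : (fun k => run.z (k + 1) - zs) =o[atTop] fun k => run.z k - zs := by
    refine (run.isBigO_z_succ_sub ht htA.differentiableAt htzs hGd hGId
      (hunit.congr' hu.symm)).trans_isLittleO (hstep.congr' ?_ EventuallyEq.rfl)
    filter_upwards [hu] with k hk
    rw [hk]
  refine ⟨?_, hlim, Or.inr hrate.norm_norm.tendsto_div_nhds_zero⟩
  filter_upwards [hback] with k hk
  simp [SpiralRun.τ, hk]
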